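/- For $p,q\in\mathbb R$ the Gini mean $G_{p,q}:\bigcup_{n\ge1}(0,\infty)^n\to(0,\infty)$ is defined by $$G_{p,q}(x_1,\dots,x_n)=\begin{cases}\left(\dfrac{x_1^p+\cdots+x_n^p}{x_1^q+\cdots+x_n^q}\right)^{\frac1{p-q}} & p\ne q,\\[4mm] \exp\left(\dfrac{x_1^p\ln x_1+\cdots+x_n^p\ln x_n}{x_1^p+\cdots+x_n^p}\right) & p=q.\end{cases}$$ The Hardy constant $\mathcal H(M)\in[0,\infty]$ of a mean $M:\bigcup_{n\ge1}(0,\infty)^n\to(0,\infty)$ is the smallest extended real number such that $$\sum_{n=1}^\infty M(x_1,\dots,x_n)\le\mathcal H(M)\sum_{n=1}^\infty x_n$$ for all sequences $(x_n)_{n\ge1}$ of positive real numbers, and $M$ is called a Hardy mean if $\mathcal H(M)<\infty$. The mean $M$ is called increasing (concave) if, for every $n\ge1$, its restriction to $(0,\infty)^n$ is nondecreasing in each variable (is a concave function). **Corollary.** Let $p,q\in\mathbb R$. The Gini mean $G_{p,q}$ is increasing and concave if and only if $$\min(p,q)\le0\le\max(p,q)\le1.$$ In this case, $G_{p,q}$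 is a Hardy mean if and only if $\max(p,q)<1$, and then $$\mathcal H(G_{p,q})=\begin{cases}\left(\dfrac{1-p}{1-q}\right)^{\frac1{q-p}} & p\ne q,\\[3mm] e & p=q=0.\end{cases}$$ -/

import Mathlib

open scoped ENNReal

noncomputable section

namespace HardyMeans

/-- A (candidate) mean in every finite number of variables; only its values at tuples of positive
reals of length at least one are ever used. -/
abbrev MultiMean := (n : ℕ) → (Fin n → ℝ) → ℝ

/-- The open positive orthant `(0, ∞)ⁿ`. -/
def posOrthant (n : ℕ) : Set (Fin n → ℝ) := {x | ∀ i, 0 < x i}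

/-- `M` is (not necessarily strictly) increasing in each of its variables on `(0, ∞)ⁿ`,
for every `n ≥ 1`. -/
def IsIncreasing (M : MultiMean) : Prop :=
  ∀ n : ℕ, 1 ≤ n → ∀ x ∈ posOrthant n, ∀ i : Fin n,
    MonotoneOn (fun t : ℝ => M n (Function.update x i t)) (Set.Ioi 0)

/-- `M` is concave on `(0, ∞)ⁿ` for every `n ≥ 1`. -/
def IsConcave (M : MultiMean) : Prop :=
  ∀ n : ℕ, 1 ≤ n → ConcaveOn ℝ (posOrthant n) (M n)

/-- `∑ M(x₁, …, xₙ) ≤ C ∑ xₙ` for all sequences of positive reals; the sums run over all `n ≥ 1` and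
are taken in `[0, ∞]`, and the sequence `x₁, x₂, …` is indexed from `0`. -/
def IsHardyBound (M : MultiMean) (C : ℝ≥0∞) : Prop :=
  ∀ x : ℕ → ℝ, (∀ n, 0 < x n) →
    ∑' n : ℕ, ENNReal.ofReal (M (n + 1) (fun i : Fin (n + 1) => x i)) ≤
      C * ∑' n : ℕ, ENNReal.ofReal (x n)

/-- The Hardy constant of `M`, an extended nonnegative real. -/
def hardyConst (M : MultiMean) : ℝ≥0∞ := sInf {C : ℝ≥0∞ | IsHardyBound M C}

/-- `M` is a Hardy mean if its Hardy constant is finite. -/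
def IsHardyMean (M : MultiMean) : Prop := hardyConst M < ∞

/-- The Gini mean of parameters `p`, `q`. -/
def gini (p q : ℝ) : MultiMean := fun _ x =>
  if p = q then Real.exp ((∑ i, x i ^ p * Real.log (x i)) / ∑ i, x i ^ p)
  else ((∑ i, x i ^ p) / ∑ i, x i ^ q) ^ (1 / (p - q))

/-- The function `χ` that generates the Gini mean. -/
def chi (p q x : ℝ) : ℝ :=
  if p = q then x ^ p * Real.log x else (x ^ p - x ^ q) / (p - q)

/-- The deviation function of the Gini mean. -/
def giniDeviation (p q x y : ℝ) : ℝ := y ^ p * chi p q (x / y)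

/-- The Hardy constant of a positive-valued `M` is the smallest admissible constant. -/
theorem isLeast_hardyConst (M : MultiMean)
    (hM : ∀ n : ℕ, 1 ≤ n → ∀ x ∈ posOrthant n, 0 < M n x) :
    IsLeast {C : ℝ≥0∞ | IsHardyBound M C} (hardyConst M) := by
  have key : ∀ x : ℕ → ℝ, (∀ n, 0 < x n) → ∑' n : ℕ, ENNReal.ofReal (x n) ≠ ∞ →
      ∑' n : ℕ, ENNReal.ofReal (M (n + 1) (fun i : Fin (n + 1) => x i)) ≤
      hardyConst M * ∑' n : ℕ, ENNReal.ofReal (x n) := by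
    intro x hx hS
    have hS0 : ∑' n : ℕ, ENNReal.ofReal (x n) ≠ 0 := by
      intro h
      have := ENNReal.tsum_eq_zero.1 h 0
      rw [ENNReal.ofReal_eq_zero] at this
      exact absurd (hx 0) (not_lt.2 this)
    rw [← ENNReal.div_le_iff hS0 hS]
    exact le_sInf fun C hC => (ENNReal.div_le_iff hS0 hS).2 (hC x hx)
  refine ⟨?_, fun C hC => sInf_le hC⟩
  intro x hx
  by_cases hS : ∑' n : ℕ, ENNReal.ofReal (x n) = ∞
  · have h0 : hardyConst M ≠ 0 := by
      intro h
      have hpos : ∀ n : ℕ, 0 < (1 / 2 : ℝ) ^ n := fun n => by positivity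
      have h1 := key (fun n => (1 / 2 : ℝ) ^ n) hpos
        (summable_geometric_two.tsum_ofReal_ne_top)
      rw [h, zero_mul, nonpos_iff_eq_zero] at h1
      have h2 := ENNReal.tsum_eq_zero.1 h1 0
      rw [ENNReal.ofReal_eq_zero] at h2
      exact absurd (hM 1 le_rfl (fun i : Fin 1 => (1 / 2 : ℝ) ^ (i : ℕ)) fun i => hpos i)
        (not_lt.2 h2)
    rw [hS, ENNReal.mul_top h0]
    exact le_top
  · exact key x hx hS

/-- The Gini mean is the deviation mean generated by `giniDeviation p q`: at a tuple of positive
reals its value is the unique positive solution `y` of `∑ E(xᵢ, y) = 0`. -/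
theorem sum_giniDeviation_eq_zero_iff (p q : ℝ) (n : ℕ) (hn : 1 ≤ n) (x : Fin n → ℝ)
    (hx : x ∈ posOrthant n) :
    0 < gini p q n x ∧
      ∀ y : ℝ, 0 < y → (∑ i, giniDeviation p q (x i) y = 0 ↔ y = gini p q n x) := by
  have hS : ∀ r : ℝ, 0 < ∑ i, x i ^ r := fun r =>
    Finset.sum_pos (fun i _ => Real.rpow_pos_of_pos (hx i) r) ⟨⟨0, hn⟩, Finset.mem_univ _⟩
  by_cases hpq : p = q
  · subst hpq
    simp only [gini, giniDeviation, chi, if_true]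
    refine ⟨Real.exp_pos _, fun y hy => ?_⟩
    have h1 : ∑ i, y ^ p * ((x i / y) ^ p * Real.log (x i / y)) =
        ∑ i, x i ^ p * Real.log (x i) - (∑ i, x i ^ p) * Real.log y := by
      rw [Finset.sum_mul, ← Finset.sum_sub_distrib]
      refine Finset.sum_congr rfl fun i _ => ?_
      rw [Real.div_rpow (hx i).le hy.le, Real.log_div (hx i).ne' hy.ne']
      have := (Real.rpow_pos_of_pos hy p).ne'
      field_simp
    rw [h1, sub_eq_zero]
    constructor
    · intro h
      rw [h, mul_div_cancel_left₀ _ (hS p).ne', Real.exp_log hy]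
    · intro h
      rw [h, Real.log_exp, mul_div_cancel₀ _ (hS p).ne']
  · simp only [gini, giniDeviation, chi, if_neg hpq]
    have hpq' : p - q ≠ 0 := sub_ne_zero.2 hpq
    have hR : 0 < (∑ i, x i ^ p) / ∑ i, x i ^ q := div_pos (hS p) (hS q)
    refine ⟨Real.rpow_pos_of_pos hR _, fun y hy => ?_⟩
    have h1 : ∑ i, y ^ p * (((x i / y) ^ p - (x i / y) ^ q) / (p - q)) =
        (∑ i, x i ^ p - (∑ i, x i ^ q) * y ^ (p - q)) / (p - q) := by
      rw [Finset.sum_mul, ← Finset.sum_sub_distrib, Finset.sum_div]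
      refine Finset.sum_congr rfl fun i _ => ?_
      rw [Real.div_rpow (hx i).le hy.le, Real.div_rpow (hx i).le hy.le, Real.rpow_sub hy]
      have := (Real.rpow_pos_of_pos hy p).ne'
      have := (Real.rpow_pos_of_pos hy q).ne'
      field_simp
    rw [h1, div_eq_zero_iff, or_iff_left hpq', sub_eq_zero, one_div,
      Real.eq_rpow_inv hy.le hR.le hpq', eq_div_iff (hS q).ne', mul_comm, eq_comm]

end HardyMeans

end

noncomputable section

namespace HardyMeans

open Filter Topology

/-! Convexity questions reduce to one variable: by `le_gini_iff`, y ≤ G(x) exactly when ∑ χ(xᵢ/y) ≥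
0. If χ is increasing and concave, so is G. Conversely, χ(t) is the rescaled effect on G of one
entry t among many ones (`tendsto_gini_update_one`), so χ inherits both properties, and its
behaviour near 0 and ∞ forces the parameter conditions.

For the Hardy constant, `kedlaya_gini` bounds the average of the partial Gini means by G(A₁, …, Aₙ),
with Aⱼ the partial arithmetic means. Since Aⱼ ≤ S/j for the total S, monotonicity and homogeneity
give the factor n·G(1, 1/2, …, 1/n). Its limit is optimal, as truncated harmonic sequences show
(`IsHardyBound.ofReal_le`), because the harmonic series diverges. The limit comes from asymptotics
of power sums, or from a Cesàro mean when p = q = 0; it is infinite when the larger parameter is 1.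
-/

/-! ### Gini means through the one-variable function `chi` -/

theorem chi_comm (p q x : ℝ) : chi p q x = chi q p x := by
  by_cases h : p = q
  · subst h; rfl
  · rw [chi, chi, if_neg h, if_neg (Ne.symm h), ← neg_sub (x ^ q), ← neg_sub q p, neg_div_neg_eq]

theorem sum_rpow_pos {n : ℕ} (hn : 1 ≤ n) {x : Fin n → ℝ} (hx : x ∈ posOrthant n) (r : ℝ) :
    0 < ∑ i, x i ^ r :=
  Finset.sum_pos (fun i _ => Real.rpow_pos_of_pos (hx i) r) ⟨⟨0, hn⟩, Finset.mem_univ _⟩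

theorem gini_pos (p q : ℝ) {n : ℕ} (hn : 1 ≤ n) {x : Fin n → ℝ} (hx : x ∈ posOrthant n) :
    0 < gini p q n x :=
  (sum_giniDeviation_eq_zero_iff p q n hn x hx).1

theorem gini_comm (p q : ℝ) {n : ℕ} (hn : 1 ≤ n) {x : Fin n → ℝ} (hx : x ∈ posOrthant n) :
    gini p q n x = gini q p n x := by
  by_cases h : p = q
  · subst h; rfl
  · have hp := sum_rpow_pos hn hx p
    have hq := sum_rpow_pos hn hx q
    rw [gini, gini, if_neg h, if_neg (Ne.symm h), ← inv_div (∑ i, x i ^ p),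
      Real.inv_rpow (div_pos hp hq).le, ← Real.rpow_neg (div_pos hp hq).le, ← neg_sub p q,
      div_neg, neg_neg]

/-- The Gini mean dominates `y` precisely when the total deviation from `y` is nonnegative. -/
theorem le_gini_iff (p q : ℝ) {n : ℕ} (hn : 1 ≤ n) {x : Fin n → ℝ} (hx : x ∈ posOrthant n)
    {y : ℝ} (hy : 0 < y) : y ≤ gini p q n x ↔ 0 ≤ ∑ i, chi p q (x i / y) := by
  -- With p - q positive, taking the power 1/(p - q) preserves inequalities.
  wlog hpq : q ≤ p generalizing p q
  · rw [gini_comm p q hn hx, this q p (le_of_not_ge hpq)]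
    simp only [chi_comm p q]
  have hS := sum_rpow_pos hn hx
  rcases hpq.eq_or_lt with rfl | hlt
  · have h1 : ∑ i, chi q q (x i / y) =
        (∑ i, x i ^ q * Real.log (x i) - (∑ i, x i ^ q) * Real.log y) / y ^ q := by
      rw [Finset.sum_mul, ← Finset.sum_sub_distrib, Finset.sum_div]
      refine Finset.sum_congr rfl fun i _ => ?_
      rw [chi, if_pos rfl, Real.div_rpow (hx i).le hy.le, Real.log_div (hx i).ne' hy.ne']
      ring
    rw [h1, le_div_iff₀ (Real.rpow_pos_of_pos hy q), zero_mul, sub_nonneg, gini, if_pos rfl,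
      ← Real.log_le_iff_le_exp hy, le_div_iff₀' (hS q)]
  · have hd : 0 < p - q := sub_pos.2 hlt
    have h1 : ∑ i, chi p q (x i / y) =
        (∑ i, x i ^ p - (∑ i, x i ^ q) * y ^ (p - q)) / ((p - q) * y ^ p) := by
      rw [Finset.sum_mul, ← Finset.sum_sub_distrib, Finset.sum_div]
      refine Finset.sum_congr rfl fun i _ => ?_
      rw [chi, if_neg hlt.ne', Real.div_rpow (hx i).le hy.le, Real.div_rpow (hx i).le hy.le,
        Real.rpow_sub hy]
      have := (Real.rpow_pos_of_pos hy p).ne'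
      have := (Real.rpow_pos_of_pos hy q).ne'
      field_simp
    rw [h1, le_div_iff₀ (mul_pos hd (Real.rpow_pos_of_pos hy p)), zero_mul, sub_nonneg,
      gini, if_neg hlt.ne', one_div, Real.le_rpow_inv_iff_of_pos hy.le (div_pos (hS p) (hS q)).le hd,
      le_div_iff₀' (hS q)]

theorem sum_chi_gini (p q : ℝ) {n : ℕ} (hn : 1 ≤ n) {x : Fin n → ℝ} (hx : x ∈ posOrthant n) :
    ∑ i, chi p q (x i / gini p q n x) = 0 := by
  obtain ⟨h0, h1⟩ := sum_giniDeviation_eq_zero_iff p q n hn x hx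
  have h2 := (h1 _ h0).2 rfl
  simp only [giniDeviation, ← Finset.mul_sum] at h2
  exact (mul_eq_zero.1 h2).resolve_left (Real.rpow_pos_of_pos h0 p).ne'

theorem gini_mul (p q : ℝ) {n : ℕ} (hn : 1 ≤ n) {x : Fin n → ℝ} (hx : x ∈ posOrthant n)
    {c : ℝ} (hc : 0 < c) : gini p q n (fun i => c * x i) = c * gini p q n x := by
  have hcx : (fun i => c * x i) ∈ posOrthant n := fun i => mul_pos hc (hx i)
  have key : ∀ y, 0 < y → (y ≤ gini p q n (fun i => c * x i) ↔ y / c ≤ gini p q n x) := by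
    intro y hy
    rw [le_gini_iff p q hn hcx hy, le_gini_iff p q hn hx (div_pos hy hc)]
    simp only [div_div_eq_mul_div, mul_comm]
  have h1 := gini_pos p q hn hx
  have h2 := gini_pos p q hn hcx
  apply le_antisymm
  · rw [← div_le_iff₀' hc]
    exact (key _ h2).1 le_rfl
  · rw [key _ (mul_pos hc h1), mul_div_cancel_left₀ _ hc.ne']

/-! ### Sufficiency of the parameter conditions -/

theorem convexOn_rpow_of_nonpos {q : ℝ} (hq : q ≤ 0) :
    ConvexOn ℝ (Set.Ioi 0) fun x : ℝ => x ^ q := by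
  have h1 : ConvexOn ℝ (Set.Ioi 0) fun x : ℝ => q * Real.log x := by
    have := (strictConcaveOn_log_Ioi.concaveOn.smul (neg_nonneg.2 hq)).neg
    refine this.congr fun x _ => ?_
    simp
  have h2 : ConvexOn ℝ (Set.Ioi 0) fun x : ℝ => Real.exp (q * Real.log x) :=
    ⟨h1.1, fun x hx y hy a b ha hb hab =>
      (Real.exp_le_exp.2 (h1.2 hx hy ha hb hab)).trans
        (convexOn_exp.2 (Set.mem_univ _) (Set.mem_univ _) ha hb hab)⟩
  refine h2.congr fun x hx => ?_
  rw [Real.rpow_def_of_pos hx, mul_comm]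

theorem chi_zero_zero (x : ℝ) : chi 0 0 x = Real.log x := by
  simp [chi]

/-- A concave power minus a convex one, up to a positive factor; the diagonal case can only be the
logarithm. -/
theorem concaveOn_chi {p q : ℝ} (hq : q ≤ 0) (hp : 0 ≤ p) (hp1 : p ≤ 1) :
    ConcaveOn ℝ (Set.Ioi 0) (chi p q) := by
  rcases (hq.trans hp).eq_or_lt with rfl | hlt
  · obtain rfl : q = 0 := le_antisymm hq hp
    exact strictConcaveOn_log_Ioi.concaveOn.congr fun x _ => (chi_zero_zero x).symm
  · have h1 := (((Real.concaveOn_rpow hp hp1).subset Set.Ioi_subset_Ici_self (convex_Ioi 0)).sub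
      (convexOn_rpow_of_nonpos hq)).smul (inv_nonneg.2 (sub_pos.2 hlt).le)
    refine h1.congr fun x _ => ?_
    simp [chi, if_neg hlt.ne', div_eq_inv_mul]

theorem monotoneOn_chi {p q : ℝ} (hq : q ≤ 0) (hp : 0 ≤ p) :
    MonotoneOn (chi p q) (Set.Ioi 0) := by
  intro x hx y hy hxy
  rcases (hq.trans hp).eq_or_lt with rfl | hlt
  · obtain rfl : q = 0 := le_antisymm hq hp
    rw [chi_zero_zero, chi_zero_zero]
    exact Real.log_le_log hx hxy
  · rw [chi, chi, if_neg hlt.ne', if_neg hlt.ne']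
    exact div_le_div_of_nonneg_right
      (sub_le_sub (Real.rpow_le_rpow (le_of_lt hx) hxy hp)
        (Real.rpow_le_rpow_of_nonpos hx hxy hq)) (sub_pos.2 hlt).le

theorem gini_mono {p q : ℝ} (hq : q ≤ 0) (hp : 0 ≤ p) {n : ℕ} (hn : 1 ≤ n) {x y : Fin n → ℝ}
    (hx : x ∈ posOrthant n) (hxy : x ≤ y) : gini p q n x ≤ gini p q n y := by
  have hy : y ∈ posOrthant n := fun i => (hx i).trans_le (hxy i)
  have h0 := gini_pos p q hn hx
  rw [le_gini_iff p q hn hy h0, ← sum_chi_gini p q hn hx]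
  exact Finset.sum_le_sum fun i _ => monotoneOn_chi hq hp (div_pos (hx i) h0) (div_pos (hy i) h0)
    (div_le_div_of_nonneg_right (hxy i) h0.le)

theorem isIncreasing_gini {p q : ℝ} (hq : q ≤ 0) (hp : 0 ≤ p) : IsIncreasing (gini p q) := by
  intro n hn x hx i s hs t ht hst
  refine gini_mono hq hp hn (fun j => ?_) (Function.update_mono hst)
  rcases eq_or_ne j i with rfl | h
  · rwa [Function.update_self]
  · rw [Function.update_of_ne h]
    exact hx j

theorem isConcave_gini {p q : ℝ} (hq : q ≤ 0) (hp : 0 ≤ p) (hp1 : p ≤ 1) :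
    IsConcave (gini p q) := by
  intro n hn
  have hconv : Convex ℝ (posOrthant n) := by
    have : posOrthant n = Set.univ.pi fun _ => Set.Ioi 0 := by ext; simp [posOrthant]
    rw [this]
    exact convex_pi fun _ _ => convex_Ioi 0
  refine ⟨hconv, fun x hx y hy a b ha hb hab => ?_⟩
  have hz := hconv hx hy ha hb hab
  have h1 := gini_pos p q hn hx
  have h2 := gini_pos p q hn hy
  set m := gini p q n x with hm
  set l := gini p q n y with hl
  simp only [smul_eq_mul]
  have hY : 0 < a * m + b * l := convex_Ioi (0 : ℝ) h1 h2 ha hb hab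
  rw [le_gini_iff p q hn hz hY]
  -- Jensen with weights am/(am+bl) and bl/(am+bl): they combine x i / m and y i / l into the i-th
  -- coordinate of ax + by over am + bl.
  calc 0 = ∑ i, (a * m / (a * m + b * l) * chi p q (x i / m) +
        b * l / (a * m + b * l) * chi p q (y i / l)) := by
        rw [Finset.sum_add_distrib, ← Finset.mul_sum, ← Finset.mul_sum, hm, hl,
          sum_chi_gini p q hn hx, sum_chi_gini p q hn hy]
        simp
    _ ≤ _ := Finset.sum_le_sum fun i _ => by
        have := (concaveOn_chi hq hp hp1).2 (div_pos (hx i) h1) (div_pos (hy i) h2)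
          (show 0 ≤ a * m / (a * m + b * l) by positivity)
          (show 0 ≤ b * l / (a * m + b * l) by positivity) (by field_simp)
        refine this.trans (le_of_eq ?_)
        congr 1
        simp only [Pi.add_apply, Pi.smul_apply, smul_eq_mul]
        field_simp

/-! ### Kedlaya's inequality -/

/-- Sorts the (k+l+1)-subsets of an (N+1)-set by the position of their (k+1)-st element. -/
theorem sum_antidiagonal_choose_mul_choose (N k l : ℕ) :
    ∑ ij ∈ Finset.HasAntidiagonal.antidiagonal N, ij.1.choose k * ij.2.choose l = (N + 1).choose (k + l + 1) := by
  induction N generalizing l with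
  | zero =>
    rcases k with _ | k <;> rcases l with _ | l <;> simp [Nat.choose_eq_zero_of_lt]
  | succ N ih =>
    rw [Finset.Nat.sum_antidiagonal_succ']
    rcases l with _ | l
    · have h := ih 0
      simp only [Nat.choose_zero_right, mul_one, add_zero] at h ⊢
      rw [h, Nat.choose_succ_succ (N + 1) k, add_comm]
    · simp only [Nat.choose_succ_succ _ l, mul_add, Finset.sum_add_distrib, ih,
        Nat.choose_zero_succ, mul_zero]
      rw [← add_assoc k l 1, Nat.choose_succ_succ (N + 1) (k + l + 1)]
      simp

/-- Kedlaya's hypergeometric weights. -/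
def kedlayaWeight (N i j k : ℕ) : ℝ :=
  if k ≤ j then ((N - i).choose (j - k) * i.choose k : ℕ) / (N.choose j : ℝ) else 0

theorem kedlayaWeight_nonneg (N i j k : ℕ) : 0 ≤ kedlayaWeight N i j k := by
  unfold kedlayaWeight
  split_ifs <;> positivity

theorem kedlayaWeight_eq_zero {N i j k : ℕ} (h : i < k) : kedlayaWeight N i j k = 0 := by
  simp [kedlayaWeight, Nat.choose_eq_zero_of_lt h]

/-- The weight is the probability that random subsets of sizes i and j of an N-set meet in k points,
which is symmetric in i and j. -/
theorem kedlayaWeight_comm {N i j : ℕ} (hi : i ≤ N) (hj : j ≤ N) (k : ℕ) :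
    kedlayaWeight N i j k = kedlayaWeight N j i k := by
  by_cases hki : k ≤ i
  · by_cases hkj : k ≤ j
    · have h1 : (0 : ℝ) < N.choose i := by exact_mod_cast Nat.choose_pos hi
      have h2 : (0 : ℝ) < N.choose j := by exact_mod_cast Nat.choose_pos hj
      rw [kedlayaWeight, kedlayaWeight, if_pos hki, if_pos hkj, div_eq_div_iff h2.ne' h1.ne']
      norm_cast
      have e1 := Nat.choose_mul (n := N) hki
      have e2 := Nat.choose_mul (n := N) hkj
      have e3 : (N - k).choose (i - k) * (N - i).choose (j - k) =
          (N - k).choose (j - k) * (N - j).choose (i - k) := by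
        obtain ⟨a, rfl⟩ := Nat.exists_eq_add_of_le hki
        obtain ⟨b, rfl⟩ := Nat.exists_eq_add_of_le hkj
        obtain ⟨c, rfl⟩ := Nat.exists_eq_add_of_le (hki.trans hi)
        have ha : a ≤ c := by omega
        have hb : b ≤ c := by omega
        simp only [Nat.add_sub_cancel_left, Nat.add_sub_add_left]
        have f1 := Nat.choose_mul (n := c) (k := a + b) (s := a) (by omega)
        have f2 := Nat.choose_mul (n := c) (k := a + b) (s := b) (by omega)
        simp only [Nat.add_sub_cancel_left, Nat.add_sub_cancel] at f1 f2
        rw [← f1, ← f2, Nat.choose_symm_add]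
      calc (N - i).choose (j - k) * i.choose k * N.choose i
          = N.choose i * i.choose k * (N - i).choose (j - k) := by ring
        _ = N.choose k * ((N - k).choose (i - k) * (N - i).choose (j - k)) := by rw [e1]; ring
        _ = N.choose j * j.choose k * (N - j).choose (i - k) := by rw [e3, e2]; ring
        _ = _ := by ring
    · rw [kedlayaWeight_eq_zero (not_le.1 hkj), kedlayaWeight, if_neg hkj]
  · rw [kedlayaWeight_eq_zero (not_le.1 hki), kedlayaWeight, if_neg hki]

/-- Vandermonde's identity; it makes Jensen applicable in k. -/
theorem sum_kedlayaWeight {N i j : ℕ} (hi : i ≤ N) (hj : j ≤ N) :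
    ∑ k ∈ Finset.range (N + 1), kedlayaWeight N i j k = 1 := by
  have h2 : (0 : ℝ) < N.choose j := by exact_mod_cast Nat.choose_pos hj
  have h := Nat.add_choose_eq i (N - i) j
  rw [Nat.add_sub_cancel' hi, Finset.Nat.sum_antidiagonal_eq_sum_range_succ
    (fun a b => i.choose a * (N - i).choose b)] at h
  rw [← Finset.sum_subset (Finset.range_mono (Nat.succ_le_succ hj))]
  · simp only [kedlayaWeight]
    rw [Finset.sum_congr rfl fun k hk => if_pos (Nat.lt_succ_iff.1 (Finset.mem_range.1 hk)),
      ← Finset.sum_div, div_eq_one_iff_eq h2.ne', ← Nat.cast_sum, h]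
    simp only [mul_comm, Nat.succ_eq_add_one]
  · intro k _ hk
    rw [kedlayaWeight, if_neg]
    simpa [Nat.lt_succ_iff] using hk

/-- Constancy on k ≤ j is the point: averaging over i turns the weights into those of a partial
arithmetic mean. -/
theorem sum_kedlayaWeight_left {N j : ℕ} (hj : j ≤ N) (k : ℕ) :
    ∑ i ∈ Finset.range (N + 1), kedlayaWeight N i j k =
      if k ≤ j then ((N : ℝ) + 1) / (j + 1) else 0 := by
  by_cases hk : k ≤ j
  · have h2 : (0 : ℝ) < N.choose j := by exact_mod_cast Nat.choose_pos hj
    have h := sum_antidiagonal_choose_mul_choose N k (j - k)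
    rw [Nat.add_sub_cancel' hk, Finset.Nat.sum_antidiagonal_eq_sum_range_succ
      (fun a b => a.choose k * b.choose (j - k))] at h
    simp only [kedlayaWeight, if_pos hk]
    rw [← Finset.sum_div, ← Nat.cast_sum]
    simp only [mul_comm _ (Nat.choose _ k)]
    rw [← Nat.succ_eq_add_one, h, div_eq_div_iff h2.ne' (by positivity)]
    exact_mod_cast (Nat.add_one_mul_choose_eq N j).symm
  · simp [kedlayaWeight, hk]

theorem sum_kedlayaWeight_right {N i : ℕ} (hi : i ≤ N) (k : ℕ) :
    ∑ j ∈ Finset.range (N + 1), kedlayaWeight N i j k =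
      if k ≤ i then ((N : ℝ) + 1) / (i + 1) else 0 := by
  rw [← sum_kedlayaWeight_left hi k]
  exact Finset.sum_congr rfl fun j hj =>
    kedlayaWeight_comm hi (Nat.lt_succ_iff.1 (Finset.mem_range.1 hj)) k

/-- Kedlaya's inequality: the arithmetic mean of the partial Gini means is at most the Gini mean of
the partial arithmetic means. -/
theorem kedlaya_gini {p q : ℝ} (hq : q ≤ 0) (hp : 0 ≤ p) (hp1 : p ≤ 1) (x : ℕ → ℝ)
    (hx : ∀ n, 0 < x n) (N : ℕ) :
    (∑ i ∈ Finset.range (N + 1), gini p q (i + 1) (fun k : Fin (i + 1) => x k)) / (N + 1) ≤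
      gini p q (N + 1) fun j : Fin (N + 1) =>
        (∑ k ∈ Finset.range ((j : ℕ) + 1), x k) / ((j : ℕ) + 1) := by
  set m : ℕ → ℝ := fun i => gini p q (i + 1) (fun k : Fin (i + 1) => x k) with hm
  have hm0 : ∀ i, 0 < m i := fun i => gini_pos p q (Nat.le_add_left 1 i) fun k => hx k
  have hmz : ∀ i, ∑ k ∈ Finset.range (i + 1), chi p q (x k / m i) = 0 := fun i => by
    rw [Finset.sum_range]
    exact sum_chi_gini p q (Nat.le_add_left 1 i) fun k => hx k
  have hconc := concaveOn_chi hq hp hp1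
  set s := ∑ i ∈ Finset.range (N + 1), m i with hs
  have hs0 : 0 < s := Finset.sum_pos (fun i _ => hm0 i) (by simp)
  -- The weight m i / s cancels the denominator m i, so each normalised partial mean is a double
  -- convex combination of the ratios x k / m i.
  have hA : ∀ j ≤ N, (∑ k ∈ Finset.range (j + 1), x k) / ((j : ℝ) + 1) / (s / (N + 1)) =
      ∑ i ∈ Finset.range (N + 1), m i / s * ∑ k ∈ Finset.range (N + 1),
        kedlayaWeight N i j k * (x k / m i) := by
    intro j hj
    have e1 : ∀ i, m i / s * ∑ k ∈ Finset.range (N + 1), kedlayaWeight N i j k * (x k / m i) =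
        ∑ k ∈ Finset.range (N + 1), kedlayaWeight N i j k * (x k / s) := fun i => by
      rw [Finset.mul_sum]
      refine Finset.sum_congr rfl fun k _ => ?_
      have := (hm0 i).ne'
      field_simp
    simp only [e1]
    rw [Finset.sum_comm]
    simp only [← Finset.sum_mul, sum_kedlayaWeight_left hj]
    rw [← Finset.sum_subset (Finset.range_mono (Nat.succ_le_succ hj)), Finset.sum_div,
      Finset.sum_div]
    · refine Finset.sum_congr rfl fun k hk => ?_
      rw [if_pos (Nat.lt_succ_iff.1 (Finset.mem_range.1 hk))]
      field_simp
    · intro k _ hk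
      rw [if_neg, zero_mul]
      simpa [Nat.lt_succ_iff] using hk
  rw [le_gini_iff p q (Nat.le_add_left 1 N) (fun j => div_pos
    (Finset.sum_pos (fun k _ => hx k) (by simp)) (by positivity)) (by positivity),
    ← Finset.sum_range fun j => chi p q ((∑ k ∈ Finset.range (j + 1), x k) / ((j : ℝ) + 1) /
      (s / (N + 1)))]
  -- Summed over j, the weights are constant for k ≤ i and vanish beyond, so each inner sum is a
  -- multiple of the zero total deviation `hmz i`.
  calc (0 : ℝ) = ∑ i ∈ Finset.range (N + 1), m i / s * ∑ k ∈ Finset.range (N + 1),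
        (∑ j ∈ Finset.range (N + 1), kedlayaWeight N i j k) * chi p q (x k / m i) := by
        refine (Finset.sum_eq_zero fun i hi => ?_).symm
        have hi' : i ≤ N := Nat.lt_succ_iff.1 (Finset.mem_range.1 hi)
        rw [mul_eq_zero]
        right
        rw [← Finset.sum_subset (Finset.range_mono (Nat.succ_le_succ hi'))]
        · rw [← mul_zero (((N : ℝ) + 1) / (i + 1)), ← hmz i, Finset.mul_sum]
          refine Finset.sum_congr rfl fun k hk => ?_
          rw [sum_kedlayaWeight_right hi', if_pos (Nat.lt_succ_iff.1 (Finset.mem_range.1 hk))]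
        · intro k _ hk
          rw [sum_kedlayaWeight_right hi', if_neg, zero_mul]
          simpa [Nat.lt_succ_iff] using hk
    _ = ∑ j ∈ Finset.range (N + 1), ∑ i ∈ Finset.range (N + 1), m i / s *
        ∑ k ∈ Finset.range (N + 1), kedlayaWeight N i j k * chi p q (x k / m i) := by
        rw [Finset.sum_comm]
        refine Finset.sum_congr rfl fun i _ => ?_
        rw [← Finset.mul_sum, Finset.sum_comm]
        simp only [Finset.sum_mul]
    -- Jensen twice: over k for each i, then over i.
    _ ≤ _ := Finset.sum_le_sum fun j hj => by
        have hj' : j ≤ N := Nat.lt_succ_iff.1 (Finset.mem_range.1 hj)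
        rw [hA j hj']
        have inner : ∀ i ∈ Finset.range (N + 1),
            (∑ k ∈ Finset.range (N + 1), kedlayaWeight N i j k * (x k / m i)) ∈ Set.Ioi (0 : ℝ) ∧
            ∑ k ∈ Finset.range (N + 1), kedlayaWeight N i j k * chi p q (x k / m i) ≤
              chi p q (∑ k ∈ Finset.range (N + 1), kedlayaWeight N i j k * (x k / m i)) := by
          intro i hi
          have hi' : i ≤ N := Nat.lt_succ_iff.1 (Finset.mem_range.1 hi)
          have hpos : ∀ k ∈ Finset.range (N + 1), x k / m i ∈ Set.Ioi (0 : ℝ) :=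
            fun k _ => div_pos (hx k) (hm0 i)
          have hw := sum_kedlayaWeight hi' hj'
          exact ⟨(convex_Ioi (0 : ℝ)).sum_mem (fun k _ => kedlayaWeight_nonneg N i j k) hw hpos,
            hconc.le_map_sum (fun k _ => kedlayaWeight_nonneg N i j k) hw hpos⟩
        have hw : ∑ i ∈ Finset.range (N + 1), m i / s = 1 := by
          rw [← Finset.sum_div, div_self hs0.ne']
        have hw0 : ∀ i ∈ Finset.range (N + 1), 0 ≤ m i / s := fun i _ =>
          (div_pos (hm0 i) hs0).le
        refine (Finset.sum_le_sum fun i hi =>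
          mul_le_mul_of_nonneg_left (inner i hi).2 (hw0 i hi)).trans ?_
        exact hconc.le_map_sum hw0 hw fun i hi => (inner i hi).1

/-- The Gini mean of `1, 1/2, …, 1/n`, multiplied by `n`. -/
def harmonicGini (p q : ℝ) (n : ℕ) : ℝ :=
  n * gini p q n fun k : Fin n => 1 / ((k : ℕ) + 1 : ℝ)

/-- After Kedlaya's inequality, each partial sum is replaced by the full sum, which homogeneity then
pulls out. -/
theorem sum_gini_le {p q : ℝ} (hq : q ≤ 0) (hp : 0 ≤ p) (hp1 : p ≤ 1) {x : ℕ → ℝ}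
    (hx : ∀ n, 0 < x n) (hsum : Summable x) (N : ℕ) :
    ∑ i ∈ Finset.range (N + 1), gini p q (i + 1) (fun k : Fin (i + 1) => x k) ≤
      harmonicGini p q (N + 1) * ∑' n, x n := by
  have hS : 0 < ∑' n, x n := hsum.tsum_pos (fun n => (hx n).le) 0 (hx 0)
  have h1 := kedlaya_gini hq hp hp1 x hx N
  have h2 := gini_mono hq hp (Nat.le_add_left 1 N)
    (x := fun j : Fin (N + 1) => (∑ k ∈ Finset.range ((j : ℕ) + 1), x k) / ((j : ℕ) + 1))
    (y := fun j : Fin (N + 1) => (∑' n, x n) * (1 / ((j : ℕ) + 1)))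
    (fun j => div_pos (Finset.sum_pos (fun k _ => hx k) (by simp)) (by positivity))
    (fun j => by
      simp only [mul_one_div]
      exact div_le_div_of_nonneg_right (hsum.sum_le_tsum _ fun k _ => (hx k).le) (by positivity))
  have h3 := gini_mul p q (Nat.le_add_left 1 N) (x := fun k : Fin (N + 1) => 1 / ((k : ℕ) + 1 : ℝ))
    (fun k => by positivity) hS
  have h4 := h1.trans (h2.trans h3.le)
  rw [div_le_iff₀ (by positivity)] at h4
  refine h4.trans (le_of_eq ?_)
  rw [harmonicGini]
  push_cast
  ring

theorem tendsto_nat_mul_sub_of_hasDerivAt {f : ℝ → ℝ} {f' a : ℝ} (h : HasDerivAt f f' a) :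
    Tendsto (fun n : ℕ => ((n : ℝ) + 1) * (f (a + 1 / ((n : ℝ) + 1)) - f a)) atTop (𝓝 f') := by
  have h0 : Tendsto (fun n : ℕ => 1 / ((n : ℝ) + 1)) atTop (𝓝[>] 0) :=
    tendsto_nhdsWithin_iff.2 ⟨tendsto_one_div_add_atTop_nhds_zero_nat,
      Eventually.of_forall fun n => by simp only [Set.mem_Ioi]; positivity⟩
  refine (h.tendsto_slope_zero_right.comp h0).congr fun n => ?_
  simp

/-! ### Necessity of the parameter conditions -/

theorem sum_update_one_rpow (n : ℕ) (t r : ℝ) :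
    ∑ i, (Function.update (fun _ : Fin (n + 2) => (1 : ℝ)) 0 t i) ^ r = t ^ r + (n + 1) := by
  rw [Fin.sum_univ_succ]
  simp [Function.update_self]

/-- With h = 1/(n+1), the mean of t and n+1 ones is a differentiable function of h near 0, equal to
1 at h = 0, with derivative χ(t) there. -/
theorem tendsto_gini_update_one (p q : ℝ) {t : ℝ} (ht : 0 < t) :
    Tendsto (fun n : ℕ => ((n : ℝ) + 1) *
      (gini p q (n + 2) (Function.update (fun _ => 1) 0 t) - 1)) atTop (𝓝 (chi p q t)) := by
  by_cases hpq : p = q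
  · subst hpq
    have hd : HasDerivAt (fun h : ℝ => Real.exp (h * (t ^ p * Real.log t) / (h * t ^ p + 1)))
        (t ^ p * Real.log t) 0 := by
      have h1 := ((((hasDerivAt_id (0 : ℝ)).mul_const (t ^ p * Real.log t)).div
        (((hasDerivAt_id (0 : ℝ)).mul_const (t ^ p)).add_const 1) (by simp)).exp)
      simpa using h1
    have h2 := tendsto_nat_mul_sub_of_hasDerivAt hd
    rw [chi, if_pos rfl]
    refine h2.congr fun n => ?_
    have hl : ∑ i, (Function.update (fun _ : Fin (n + 2) => (1 : ℝ)) 0 t i) ^ p *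
        Real.log (Function.update (fun _ : Fin (n + 2) => (1 : ℝ)) 0 t i) =
        t ^ p * Real.log t := by
      rw [Fin.sum_univ_succ]
      simp [Function.update_self]
    rw [gini, if_pos rfl, hl, sum_update_one_rpow]
    have h3 : (0 : ℝ) < n + 1 := by positivity
    have h4 := Real.rpow_pos_of_pos ht p
    congr 2
    · congr 1
      field_simp
      ring
    · simp
  · have hd : HasDerivAt (fun h : ℝ => ((h * t ^ p + 1) / (h * t ^ q + 1)) ^ (1 / (p - q)))
        ((t ^ p - t ^ q) / (p - q)) 0 := by
      have h1 := (((((hasDerivAt_id (0 : ℝ)).mul_const (t ^ p)).add_const 1).div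
        (((hasDerivAt_id (0 : ℝ)).mul_const (t ^ q)).add_const 1) (by simp)).rpow_const
        (p := 1 / (p - q)) (by simp))
      simpa [div_eq_mul_inv] using h1
    have h2 := tendsto_nat_mul_sub_of_hasDerivAt hd
    rw [chi, if_neg hpq]
    refine h2.congr fun n => ?_
    rw [gini, if_neg hpq, sum_update_one_rpow, sum_update_one_rpow]
    have h3 : (0 : ℝ) < n + 1 := by positivity
    have h4 := Real.rpow_pos_of_pos ht p
    have h5 := Real.rpow_pos_of_pos ht q
    congr 2
    · congr 1
      field_simp
      ring
    · simp

theorem update_one_mem_posOrthant {n : ℕ} {t : ℝ} (ht : 0 < t) (i : Fin n) :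
    Function.update (fun _ => (1 : ℝ)) i t ∈ posOrthant n := by
  intro j
  rcases eq_or_ne j i with rfl | h
  · rwa [Function.update_self]
  · rw [Function.update_of_ne h]
    exact one_pos

theorem IsIncreasing.monotoneOn_chi {p q : ℝ} (h : IsIncreasing (gini p q)) :
    MonotoneOn (chi p q) (Set.Ioi 0) := fun s hs t ht hst =>
  le_of_tendsto_of_tendsto' (tendsto_gini_update_one p q hs) (tendsto_gini_update_one p q ht)
    fun n => mul_le_mul_of_nonneg_left (sub_le_sub_right
      (h (n + 2) (by omega) (fun _ => 1) (fun _ => one_pos) 0 hs ht hst) 1) (by positivity)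

theorem IsConcave.concaveOn_chi {p q : ℝ} (h : IsConcave (gini p q)) :
    ConcaveOn ℝ (Set.Ioi 0) (chi p q) := by
  refine ⟨convex_Ioi 0, fun s hs t ht a b ha hb hab => ?_⟩
  refine le_of_tendsto_of_tendsto'
    (((tendsto_gini_update_one p q hs).const_mul a).add
      ((tendsto_gini_update_one p q ht).const_mul b))
    (tendsto_gini_update_one p q (convex_Ioi (0 : ℝ) hs ht ha hb hab)) fun n => ?_
  have h1 := (h (n + 2) (by omega)).2 (update_one_mem_posOrthant hs 0)
    (update_one_mem_posOrthant ht 0) ha hb hab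
  have h2 : a • Function.update (fun _ : Fin (n + 2) => (1 : ℝ)) 0 s +
      b • Function.update (fun _ : Fin (n + 2) => (1 : ℝ)) 0 t =
      Function.update (fun _ : Fin (n + 2) => (1 : ℝ)) 0 (a • s + b • t) := by
    ext j
    rcases eq_or_ne j 0 with rfl | hj
    · simp
    · simp [Function.update_of_ne hj, hab]
  rw [h2, smul_eq_mul, smul_eq_mul] at h1
  have h3 : (0 : ℝ) ≤ n + 1 := by positivity
  have h4 := mul_le_mul_of_nonneg_left h1 h3
  -- Since a + b = 1, the subtracted ones in the rescaled differences match on both sides.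
  have h5 : ((n : ℝ) + 1) * (a + b) = n + 1 := by rw [hab, mul_one]
  linarith

/-- If both parameters were positive, χ would tend to 0 at 0⁺ although χ(1/2) < 0. -/
theorem nonpos_of_monotoneOn_chi {p q : ℝ} (hqp : q ≤ p) (h : MonotoneOn (chi p q) (Set.Ioi 0)) :
    q ≤ 0 := by
  by_contra! hq
  have hp : 0 < p := hq.trans_le hqp
  have hneg : chi p q (1 / 2) < 0 := by
    rcases hqp.eq_or_lt with rfl | hlt
    · rw [chi, if_pos rfl]
      exact mul_neg_of_pos_of_neg (by positivity) (Real.log_neg (by norm_num) (by norm_num))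
    · rw [chi, if_neg hlt.ne']
      exact div_neg_of_neg_of_pos (sub_neg.2
        (Real.rpow_lt_rpow_of_exponent_gt (by norm_num) (by norm_num) hlt)) (sub_pos.2 hlt)
  have hlim : Tendsto (chi p q) (𝓝[>] 0) (𝓝 0) := by
    rcases hqp.eq_or_lt with rfl | hlt
    · refine (tendsto_log_mul_rpow_nhdsGT_zero hq).congr fun x => ?_
      rw [chi, if_pos rfl, mul_comm]
    · have hr : ∀ r : ℝ, 0 < r → Tendsto (fun x : ℝ => x ^ r) (𝓝[>] 0) (𝓝 0) := fun r hr => by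
        have := (Real.continuousAt_rpow_const 0 r (Or.inr hr.le)).tendsto
        rw [Real.zero_rpow hr.ne'] at this
        exact this.mono_left nhdsWithin_le_nhds
      have := ((hr p hp).sub (hr q hq)).div_const (p - q)
      rw [sub_zero, zero_div] at this
      refine this.congr fun x => ?_
      rw [chi, if_neg hlt.ne']
  refine absurd (le_of_tendsto hlim ?_) (not_le.2 hneg)
  filter_upwards [Ioo_mem_nhdsGT (show (0 : ℝ) < 1 / 2 by norm_num)] with x hx
  exact h hx.1 (by norm_num : (0 : ℝ) < 1 / 2) hx.2.le

/-- This duality turns the bound on the smaller parameter into the one on the larger. -/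
theorem chi_neg_inv (p q : ℝ) {x : ℝ} (hx : 0 < x) : chi (-q) (-p) x⁻¹ = -chi p q x := by
  have hr : ∀ r : ℝ, x⁻¹ ^ (-r) = x ^ r := fun r => by
    rw [Real.inv_rpow hx.le, Real.rpow_neg hx.le, inv_inv]
  by_cases h : p = q
  · subst h
    rw [chi, chi, if_pos rfl, if_pos rfl, hr, Real.log_inv, mul_neg]
  · rw [chi, chi, if_neg h, if_neg (fun e => h (neg_injective e).symm), hr, hr, neg_sub_neg,
      ← neg_div, neg_sub]

theorem nonneg_of_monotoneOn_chi {p q : ℝ} (hqp : q ≤ p) (h : MonotoneOn (chi p q) (Set.Ioi 0)) :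
    0 ≤ p := by
  refine neg_nonpos.1 (nonpos_of_monotoneOn_chi (neg_le_neg hqp) fun x hx y hy hxy => ?_)
  rw [← inv_inv x, ← inv_inv y, chi_neg_inv p q (inv_pos.2 hx), chi_neg_inv p q (inv_pos.2 hy)]
  exact neg_le_neg (h (inv_pos.2 hy : 0 < y⁻¹) (inv_pos.2 hx : 0 < x⁻¹) (inv_anti₀ hx hxy))

/-- For p > 1, χ grows faster than linearly, whereas concavity keeps it below the chord through 1
and 2, extended to the right. -/
theorem le_one_of_concaveOn_chi {p q : ℝ} (hq : q ≤ 0) (h : ConcaveOn ℝ (Set.Ioi 0) (chi p q)) :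
    p ≤ 1 := by
  by_contra! hp
  have hlt : q < p := by linarith
  have hd : 0 < p - q := sub_pos.2 hlt
  have hc : ∀ x, (p - q) * chi p q x = x ^ p - x ^ q := fun x => by
    rw [chi, if_neg hlt.ne', mul_div_cancel₀ _ hd.ne']
  have h1 : chi p q 1 = 0 := by rw [chi, if_neg hlt.ne']; simp
  have h2 : 0 ≤ chi p q 2 := by
    rw [chi, if_neg hlt.ne']
    exact div_nonneg (sub_nonneg.2 (Real.rpow_le_rpow_of_exponent_le one_le_two hlt.le)) hd.le
  obtain ⟨t, ht, ht2⟩ := (((tendsto_rpow_atTop (sub_pos.2 hp)).eventually_gt_atTop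
    (1 + (p - q) * chi p q 2)).and (eventually_gt_atTop 2)).exists
  have ht0 : 0 < t := by linarith
  have h3 := h.slope_anti_adjacent (x := 1) (y := 2) (z := t) (by simp) ht0 one_lt_two ht2
  rw [h1, div_le_iff₀ (sub_pos.2 ht2)] at h3
  have h4 : t ^ q ≤ 1 := Real.rpow_le_one_of_one_le_of_nonpos (by linarith) hq
  have h5 := mul_lt_mul_of_pos_right ht ht0
  rw [← Real.rpow_add_one ht0.ne', sub_add_cancel] at h5
  have h6 := mul_le_mul_of_nonneg_left h3 hd.le
  rw [mul_sub, hc t] at h6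
  have h7 := mul_nonneg hd.le h2
  nlinarith

/-! ### Asymptotics of the Gini means of `1, 1/2, …, 1/n` -/

/-- Stolz–Cesàro: the summands are compared with the increments of k ↦ k^r, which telescope to n^r.
-/
theorem tendsto_sum_rpow_div {r : ℝ} (hr : 0 < r) :
    Tendsto (fun n : ℕ => (∑ k ∈ Finset.range n, ((k : ℝ) + 1) ^ (r - 1)) / (n : ℝ) ^ r) atTop
      (𝓝 (1 / r)) := by
  set g : ℕ → ℝ := fun k => ((k + 1 : ℕ) : ℝ) ^ r - (k : ℝ) ^ r with hg
  have hg0 : ∀ k, 0 < g k := fun k => sub_pos.2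
    (Real.rpow_lt_rpow (Nat.cast_nonneg k) (by push_cast; linarith) hr)
  have hsum : ∀ n, ∑ k ∈ Finset.range n, g k = (n : ℝ) ^ r := fun n => by
    rw [Finset.sum_range_sub (fun k : ℕ => (k : ℝ) ^ r)]
    simp [Real.zero_rpow hr.ne']
  have hlim : Tendsto (fun k : ℕ => g k / ((k : ℝ) + 1) ^ (r - 1)) atTop (𝓝 r) := by
    -- At h = 1/(k+1) one has 1 - h = k/(k+1), so the difference quotient is g k / (k+1)^(r-1).
    have hd : HasDerivAt (fun h : ℝ => -(1 - h) ^ r) r 0 := by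
      have := (((hasDerivAt_id (0 : ℝ)).const_sub 1).rpow_const (p := r) (by simp)).fun_neg
      simpa using this
    refine (tendsto_nat_mul_sub_of_hasDerivAt hd).congr fun k => ?_
    have hk : (0 : ℝ) < k + 1 := by positivity
    have e1 : (1 : ℝ) - (0 + 1 / (k + 1)) = k / (k + 1) := by field_simp; ring
    rw [e1, Real.div_rpow (Nat.cast_nonneg k) hk.le, hg, Real.rpow_sub_one hk.ne']
    have := (Real.rpow_pos_of_pos hk r).ne'
    push_cast
    rw [sub_zero, Real.one_rpow]
    field_simp
    ring
  have hf : (fun k : ℕ => ((k : ℝ) + 1) ^ (r - 1) - 1 / r * g k) =o[atTop] g := by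
    rw [Asymptotics.isLittleO_iff_tendsto fun k hk => absurd hk (hg0 k).ne']
    have h1 := (hlim.inv₀ hr.ne').sub_const (1 / r)
    rw [one_div, sub_self] at h1
    refine h1.congr fun k => ?_
    have := (hg0 k).ne'
    rw [inv_div]
    field_simp
  have h2 := hf.sum_range (fun k => (hg0 k).le) (by
    simp only [hsum]
    exact (tendsto_rpow_atTop hr).comp tendsto_natCast_atTop_atTop)
  simp only [Finset.sum_sub_distrib, ← Finset.mul_sum, hsum] at h2
  have h3 := h2.tendsto_div_nhds_zero.add_const (1 / r)
  rw [zero_add] at h3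
  refine h3.congr' ?_
  filter_upwards [eventually_gt_atTop 0] with n hn
  have : ((n : ℝ) ^ r) ≠ 0 := (Real.rpow_pos_of_pos (by exact_mod_cast hn) r).ne'
  field_simp
  ring

/-- The factor n enters the power as n^(p-q) = n^(1-q)/n^(1-p), which normalises both power sums. -/
theorem harmonicGini_eq {p q : ℝ} (hpq : p ≠ q) {n : ℕ} (hn : 0 < n) :
    harmonicGini p q n =
      (((∑ k ∈ Finset.range n, ((k : ℝ) + 1) ^ (1 - p - 1)) / (n : ℝ) ^ (1 - p)) /
        ((∑ k ∈ Finset.range n, ((k : ℝ) + 1) ^ (1 - q - 1)) / (n : ℝ) ^ (1 - q))) ^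
          (1 / (p - q)) := by
  have hn0 : (0 : ℝ) < n := by exact_mod_cast hn
  have hd : p - q ≠ 0 := sub_ne_zero.2 hpq
  have hs : ∀ r : ℝ, ∑ i : Fin n, (1 / ((i : ℕ) + 1 : ℝ)) ^ r =
      ∑ k ∈ Finset.range n, ((k : ℝ) + 1) ^ (1 - r - 1) := fun r => by
    rw [Finset.sum_range]
    refine Finset.sum_congr rfl fun i _ => ?_
    rw [one_div, Real.inv_rpow (by positivity), ← Real.rpow_neg (by positivity)]
    congr 1
    ring
  have hp0 : ∀ r : ℝ, 0 ≤ ∑ k ∈ Finset.range n, ((k : ℝ) + 1) ^ (1 - r - 1) := fun r =>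
    Finset.sum_nonneg fun k _ => by positivity
  rw [harmonicGini, gini, if_neg hpq, hs, hs]
  nth_rewrite 1 [← Real.rpow_rpow_inv hn0.le hd]
  rw [← one_div, ← Real.mul_rpow (by positivity) (div_nonneg (hp0 p) (hp0 q)), Real.rpow_sub hn0,
    Real.rpow_sub hn0, Real.rpow_sub hn0, Real.rpow_one]
  congr 1
  have := (Real.rpow_pos_of_pos hn0 p).ne'
  have := (Real.rpow_pos_of_pos hn0 q).ne'
  field_simp

theorem tendsto_harmonicGini {p q : ℝ} (hpq : p ≠ q) (hp : p < 1) (hq : q < 1) :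
    Tendsto (harmonicGini p q) atTop (𝓝 (((1 - p) / (1 - q)) ^ (1 / (q - p)))) := by
  have hp' : 0 < 1 - p := sub_pos.2 hp
  have hq' : 0 < 1 - q := sub_pos.2 hq
  have h1 := ((tendsto_sum_rpow_div hp').div (tendsto_sum_rpow_div hq')
    (one_div_pos.2 hq').ne').rpow_const (p := 1 / (p - q))
    (Or.inl (div_pos (one_div_pos.2 hp') (one_div_pos.2 hq')).ne')
  have e : (1 / (1 - p) / (1 / (1 - q))) ^ (1 / (p - q)) =
      ((1 - p) / (1 - q)) ^ (1 / (q - p)) := by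
    rw [← neg_sub p q, div_neg, Real.rpow_neg (div_pos hp' hq').le,
      ← Real.inv_rpow (div_pos hp' hq').le]
    congr 1
    field_simp
  rw [e] at h1
  refine h1.congr' ?_
  filter_upwards [eventually_gt_atTop 0] with n hn
  rw [harmonicGini_eq hpq hn]
  rfl

/-- At p = 1 the numerator is the unnormalised harmonic sum, while the denominator keeps a positive
limit. -/
theorem tendsto_harmonicGini_one {q : ℝ} (hq : q < 1) :
    Tendsto (harmonicGini 1 q) atTop atTop := by
  have hq' : 0 < 1 - q := sub_pos.2 hq
  have h1 : Tendsto (fun n : ℕ => (∑ k ∈ Finset.range n, ((k : ℝ) + 1) ^ ((1 : ℝ) - 1 - 1)) /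
      (n : ℝ) ^ ((1 : ℝ) - 1)) atTop atTop := by
    refine Real.tendsto_sum_range_one_div_nat_succ_atTop.congr fun n => ?_
    simp [Real.rpow_neg_one]
  have h2 := h1.atTop_mul_pos (inv_pos.2 (one_div_pos.2 hq'))
    ((tendsto_sum_rpow_div hq').inv₀ (one_div_pos.2 hq').ne')
  refine ((tendsto_rpow_atTop (one_div_pos.2 hq')).comp h2).congr' ?_
  filter_upwards [eventually_gt_atTop 0] with n hn
  rw [harmonicGini_eq hq.ne' hn]
  simp only [Function.comp, div_eq_mul_inv _ (_ / _)]

/-- The logarithm, log n - (1/n) ∑ log k, is by summation by parts the Cesàro mean of k log(1 +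
1/k), which tends to 1. -/
theorem tendsto_harmonicGini_zero_zero :
    Tendsto (harmonicGini 0 0) atTop (𝓝 (Real.exp 1)) := by
  have h1 : Tendsto (fun k : ℕ => (k : ℝ) * Real.log ((k + 1 : ℕ) : ℝ) - k * Real.log k) atTop
      (𝓝 1) := by
    refine ((Real.tendsto_mul_log_one_add_div_atTop 1).comp tendsto_natCast_atTop_atTop).congr' ?_
    filter_upwards [eventually_gt_atTop 0] with k hk
    have hk0 : (0 : ℝ) < k := by exact_mod_cast hk
    have e : 1 + 1 / (k : ℝ) = (k + 1) / k := by field_simp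
    simp only [Function.comp]
    rw [e, Real.log_div (by positivity) hk0.ne']
    push_cast
    ring
  refine ((Real.continuous_exp.tendsto 1).comp h1.cesaro).congr' ?_
  filter_upwards [eventually_gt_atTop 0] with n hn
  have hn0 : (0 : ℝ) < n := by exact_mod_cast hn
  have e1 : ∀ n : ℕ, ∑ k ∈ Finset.range n, ((k : ℝ) * Real.log ((k + 1 : ℕ) : ℝ) -
      k * Real.log k) = n * Real.log n - ∑ k ∈ Finset.range n, Real.log ((k : ℝ) + 1) := by
    intro n
    induction n with
    | zero => simp
    | succ n ih =>
      rw [Finset.sum_range_succ, Finset.sum_range_succ, ih]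
      push_cast
      ring
  have e2 : ∑ i : Fin n, Real.log (1 / ((i : ℕ) + 1 : ℝ)) =
      -∑ k ∈ Finset.range n, Real.log ((k : ℝ) + 1) := by
    rw [Finset.sum_range, ← Finset.sum_neg_distrib]
    simp
  simp only [Function.comp, e1, harmonicGini, gini, if_true, Real.rpow_zero, one_mul, e2,
    Finset.sum_const, Finset.card_univ, Fintype.card_fin, nsmul_eq_mul, mul_one]
  rw [← Real.exp_log hn0, ← Real.exp_add, Real.exp_log hn0]
  congr 1
  field_simp
  ring

/-! ### The Hardy constant -/

/-- Testing a Hardy bound on truncations of the harmonic sequence. -/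
theorem IsHardyBound.ofReal_le {M : MultiMean} {C : ℝ≥0∞} (hC : IsHardyBound M C) {L : ℝ}
    (hL : ∀ᶠ n : ℕ in atTop, L ≤ n * M n fun k : Fin n => 1 / ((k : ℕ) + 1 : ℝ)) :
    ENNReal.ofReal L ≤ C := by
  by_contra! hlt
  have hCtop : C ≠ ∞ := hlt.ne_top
  have hL0 : 0 < L := ENNReal.ofReal_pos.1 (pos_of_gt hlt)
  set c := C.toReal with hc
  have hcL : c < L := (ENNReal.lt_ofReal_iff_toReal_lt hCtop).1 hlt
  obtain ⟨n₀, hn₀⟩ := eventually_atTop.1 hL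
  set H : ℕ → ℝ := fun n => ∑ k ∈ Finset.range n, 1 / ((k : ℝ) + 1) with hH
  have key : ∀ N, n₀ ≤ N → L * (H N - H n₀) ≤ c * (H N + 2) := by
    intro N hN
    -- Entries must stay positive, so the truncation is continued by a geometric tail, of total at
    -- most 2.
    set x : ℕ → ℝ := fun k => if k < N then 1 / ((k : ℝ) + 1) else (1 / 2) ^ k with hx
    have hx0 : ∀ k, 0 < x k := fun k => by
      simp only [hx]
      split_ifs <;> positivity
    have hxsum : ∑' k, ENNReal.ofReal (x k) ≤ ENNReal.ofReal (H N + 2) := by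
      have h1 : ∀ k, ENNReal.ofReal (x k) ≤
          (if k ∈ Finset.range N then ENNReal.ofReal (1 / ((k : ℝ) + 1)) else 0) +
            ENNReal.ofReal ((1 / 2) ^ k) := fun k => by
        simp only [hx, Finset.mem_range]
        split_ifs
        · exact le_self_add
        · rw [zero_add]
      refine (ENNReal.tsum_le_tsum h1).trans ?_
      rw [ENNReal.tsum_add, ENNReal.ofReal_add (by positivity) (by norm_num)]
      refine add_le_add ?_ ?_
      · rw [tsum_eq_sum (s := Finset.range N) fun k hk => if_neg hk,
          Finset.sum_congr rfl fun k hk => if_pos hk,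
          ENNReal.ofReal_sum_of_nonneg fun k _ => by positivity]
      · rw [← ENNReal.ofReal_tsum_of_nonneg (fun k => by positivity) summable_geometric_two,
          tsum_geometric_two]
    have hlow : ENNReal.ofReal (L * (H N - H n₀)) ≤
        ∑' n : ℕ, ENNReal.ofReal (M (n + 1) (fun i : Fin (n + 1) => x i)) := by
      refine le_trans ?_ (ENNReal.sum_le_tsum (Finset.Ico n₀ N))
      rw [hH, ← Finset.sum_Ico_eq_sub _ hN, Finset.mul_sum,
        ENNReal.ofReal_sum_of_nonneg fun k _ => by positivity]
      refine Finset.sum_le_sum fun n hn => ENNReal.ofReal_le_ofReal ?_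
      obtain ⟨hn1, hn2⟩ := Finset.mem_Ico.1 hn
      -- For n < N the mean sees only harmonic entries, so it is at least L/(n+1).
      have h2 := hn₀ (n + 1) (by omega)
      have h3 : (fun i : Fin (n + 1) => x i) = fun k : Fin (n + 1) => 1 / ((k : ℕ) + 1 : ℝ) := by
        ext i
        exact if_pos (by omega)
      rw [h3, mul_one_div, div_le_iff₀' (by positivity)]
      exact_mod_cast h2
    have h4 := hlow.trans ((hC x hx0).trans (mul_le_mul_right hxsum C))
    rw [← ENNReal.ofReal_toReal hCtop, ← hc, ← ENNReal.ofReal_mul ENNReal.toReal_nonneg] at h4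
    exact (ENNReal.ofReal_le_ofReal_iff (mul_nonneg ENNReal.toReal_nonneg (by positivity))).1 h4
  -- As c < L, `key` would bound the divergent sums H N.
  obtain ⟨N, hN1, hN2⟩ := ((Real.tendsto_sum_range_one_div_nat_succ_atTop.eventually_gt_atTop
    ((2 * c + L * H n₀) / (L - c))).and (eventually_ge_atTop n₀)).exists
  rw [div_lt_iff₀ (sub_pos.2 hcL)] at hN1
  have h5 := key N hN2
  simp only [hH] at h5 hN1
  linarith

theorem hardyConst_eq_of_tendsto {p q ℓ : ℝ} (hq : q ≤ 0) (hp : 0 ≤ p) (hp1 : p ≤ 1) (hℓ : 0 < ℓ)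
    (hlim : Tendsto (harmonicGini p q) atTop (𝓝 ℓ)) :
    hardyConst (gini p q) = ENNReal.ofReal ℓ := by
  apply le_antisymm
  · refine sInf_le fun x hx => ?_
    by_cases hS : ∑' n : ℕ, ENNReal.ofReal (x n) = ∞
    · rw [hS, ENNReal.mul_top (ENNReal.ofReal_pos.2 hℓ).ne']
      exact le_top
    have hsum : Summable x := by
      have h := ENNReal.summable_toReal hS
      exact h.congr fun n => ENNReal.toReal_ofReal (hx n).le
    have hm : ∀ i, 0 ≤ gini p q (i + 1) (fun k : Fin (i + 1) => x k) := fun i =>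
      (gini_pos p q (Nat.le_add_left 1 i) fun k => hx k).le
    rw [← ENNReal.ofReal_tsum_of_nonneg (fun n => (hx n).le) hsum, ← ENNReal.ofReal_mul hℓ.le]
    refine ENNReal.tsum_le_of_sum_range_le fun n => ?_
    rw [← ENNReal.ofReal_sum_of_nonneg fun i _ => hm i]
    -- The partial sum up to n is fixed while the bounds for larger N pass to the limit, so the
    -- factor need not be monotone in N.
    refine ENNReal.ofReal_le_ofReal (ge_of_tendsto
      ((hlim.comp (tendsto_add_atTop_nat 1)).mul_const (∑' n, x n)) ?_)
    filter_upwards [eventually_ge_atTop n] with N hN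
    exact (Finset.sum_le_sum_of_subset_of_nonneg (Finset.range_mono (by omega))
      fun i _ _ => hm i).trans (sum_gini_le hq hp hp1 hx hsum N)
  · refine le_sInf fun C hC => ?_
    by_contra! hlt
    have hc : C.toReal < ℓ := (ENNReal.lt_ofReal_iff_toReal_lt hlt.ne_top).1 hlt
    obtain ⟨L, hcL, hLℓ⟩ := exists_between hc
    have h1 := hC.ofReal_le (hlim.eventually_const_le hLℓ)
    rw [ENNReal.ofReal_le_iff_le_toReal hlt.ne_top] at h1
    exact absurd h1 (not_le.2 hcL)

theorem hardyConst_eq_top {q : ℝ} (hq : q < 1) : hardyConst (gini 1 q) = ∞ := by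
  refine sInf_eq_top.2 fun C hC => ENNReal.eq_top_of_forall_nnreal_le fun r => ?_
  rw [← ENNReal.ofReal_coe_nnreal]
  exact hC.ofReal_le ((tendsto_harmonicGini_one hq).eventually_ge_atTop _)

/-! ### Symmetry in the parameters -/

theorem isIncreasing_gini_comm {p q : ℝ} (h : IsIncreasing (gini p q)) :
    IsIncreasing (gini q p) := by
  intro n hn x hx i
  refine (h n hn x hx i).congr fun t ht => gini_comm p q hn fun j => ?_
  rcases eq_or_ne j i with rfl | hj
  · rwa [Function.update_self]
  · rw [Function.update_of_ne hj]
    exact hx j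

theorem isConcave_gini_comm {p q : ℝ} (h : IsConcave (gini p q)) : IsConcave (gini q p) :=
  fun n hn => (h n hn).congr fun _ hx => gini_comm p q hn hx

theorem hardyConst_gini_comm (p q : ℝ) : hardyConst (gini p q) = hardyConst (gini q p) := by
  have h : ∀ C, IsHardyBound (gini p q) C ↔ IsHardyBound (gini q p) C := fun C =>
    forall₂_congr fun x hx => by
      simp only [fun n : ℕ => gini_comm p q (Nat.le_add_left 1 n)
        (x := fun i : Fin (n + 1) => x i) fun i => hx i]
  simp only [hardyConst, h]

/-! ### The corollary for q ≤ p, then in general -/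

theorem isIncreasing_and_isConcave_gini_iff {p q : ℝ} (hqp : q ≤ p) :
    (IsIncreasing (gini p q) ∧ IsConcave (gini p q)) ↔ (q ≤ 0 ∧ 0 ≤ p ∧ p ≤ 1) := by
  constructor
  · rintro ⟨hi, hc⟩
    have hq := nonpos_of_monotoneOn_chi hqp hi.monotoneOn_chi
    exact ⟨hq, nonneg_of_monotoneOn_chi hqp hi.monotoneOn_chi,
      le_one_of_concaveOn_chi hq hc.concaveOn_chi⟩
  · rintro ⟨hq, hp, hp1⟩
    exact ⟨isIncreasing_gini hq hp, isConcave_gini hq hp hp1⟩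

theorem hardyConst_gini {p q : ℝ} (hq : q ≤ 0) (hp : 0 ≤ p) (hpq : p ≠ q) (hp1 : p < 1) :
    hardyConst (gini p q) = ENNReal.ofReal (((1 - p) / (1 - q)) ^ (1 / (q - p))) :=
  hardyConst_eq_of_tendsto hq hp hp1.le
    (Real.rpow_pos_of_pos (div_pos (by linarith) (by linarith)) _)
    (tendsto_harmonicGini hpq hp1 (by linarith))

theorem hardyConst_gini_zero_zero :
    hardyConst (gini 0 0) = ENNReal.ofReal (Real.exp 1) :=
  hardyConst_eq_of_tendsto le_rfl le_rfl zero_le_one (Real.exp_pos 1)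
    tendsto_harmonicGini_zero_zero

theorem isHardyMean_gini_iff {p q : ℝ} (hq : q ≤ 0) (hp : 0 ≤ p) (hp1 : p ≤ 1) :
    IsHardyMean (gini p q) ↔ p < 1 := by
  rw [IsHardyMean]
  constructor
  · intro h
    refine hp1.lt_of_ne fun e => ?_
    subst e
    rw [hardyConst_eq_top (by linarith)] at h
    exact lt_irrefl _ h
  · intro h
    rcases eq_or_ne p q with rfl | hpq
    · obtain rfl : p = 0 := le_antisymm hq hp
      rw [hardyConst_gini_zero_zero]
      exact ENNReal.ofReal_lt_top
    · rw [hardyConst_gini hq hp hpq h]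
      exact ENNReal.ofReal_lt_top

end HardyMeans

end

theorem mainTheorem7 (p q : ℝ) :
    ((HardyMeans.IsIncreasing (HardyMeans.gini p q) ∧ HardyMeans.IsConcave (HardyMeans.gini p q)) ↔
      (min p q ≤ 0 ∧ 0 ≤ max p q ∧ max p q ≤ 1)) ∧
    ((min p q ≤ 0 ∧ 0 ≤ max p q ∧ max p q ≤ 1) →
      (HardyMeans.IsHardyMean (HardyMeans.gini p q) ↔ max p q < 1) ∧
      (max p q < 1 →
        (p ≠ q → HardyMeans.hardyConst (HardyMeans.gini p q) =
          ENNReal.ofReal (((1 - p) / (1 - q)) ^ (1 / (q - p)))) ∧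
        (p = 0 ∧ q = 0 → HardyMeans.hardyConst (HardyMeans.gini p q) =
          ENNReal.ofReal (Real.exp 1)))) := by
  wlog hqp : q ≤ p generalizing p q
  · have h := this q p (le_of_not_ge hqp)
    rw [min_comm q p, max_comm q p] at h
    refine ⟨⟨fun hM => h.1.1 ⟨HardyMeans.isIncreasing_gini_comm hM.1,
      HardyMeans.isConcave_gini_comm hM.2⟩, fun hM => ?_⟩, fun hc => ?_⟩
    · obtain ⟨h1, h2⟩ := h.1.2 hM
      exact ⟨HardyMeans.isIncreasing_gini_comm h1, HardyMeans.isConcave_gini_comm h2⟩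
    · obtain ⟨h1, h2⟩ := h.2 hc
      have hp1 : p ≤ 1 := (le_max_left p q).trans hc.2.2
      rw [HardyMeans.IsHardyMean, HardyMeans.hardyConst_gini_comm p q]
      refine ⟨h1, fun hlt => ⟨fun hne => ?_, fun h0 => (h2 hlt).2 h0.symm⟩⟩
      have hp : 0 < 1 - p := sub_pos.2 ((le_max_left p q).trans_lt hlt)
      have hq : 0 < 1 - q := sub_pos.2 ((le_max_right p q).trans_lt hlt)
      -- Swapping p and q inverts the base and negates the exponent, so the closed form is
      -- symmetric.
      rw [(h2 hlt).1 hne.symm, ← inv_div (1 - p), Real.inv_rpow (div_pos hp hq).le,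
        ← Real.rpow_neg (div_pos hp hq).le, ← div_neg, neg_sub]
  · rw [min_eq_right hqp, max_eq_left hqp]
    refine ⟨HardyMeans.isIncreasing_and_isConcave_gini_iff hqp, fun ⟨hq, hp, hp1⟩ =>
      ⟨HardyMeans.isHardyMean_gini_iff hq hp hp1, fun hlt =>
        ⟨fun hne => HardyMeans.hardyConst_gini hq hp hne hlt, ?_⟩⟩⟩
    rintro ⟨rfl, rfl⟩
    exact HardyMeans.hardyConst_gini_zero_zero
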